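/- **Setting.** Consider a sequence of linear regression models $Y=X\beta+\varepsilon=\sum_{k=1}^pX_k\beta_k+\varepsilon$ (the index of the sequence is suppressed), where $X_k$ is a deterministic $n\times d_k$ matrix with $d_k\ge1$, $\beta_k\in\mathbb R^{d_k}$, and the errors $\varepsilon_1,\dots,\varepsilon_n$ are i.i.d. $N(0,\sigma^2)$ with $\sigma>0$. Let $\lambda$ be the penalty level and let $\hat\beta$ be a group Lasso estimate, i.e. a minimizer over $b=(b_1,\dots,b_p)$ of $$\tfrac12\|Y-Xb\|_2^2+\lambda\sum_{k=1}^p\sqrt{d_k}\,\|b_k\|_2 .$$ Let $A_0\subset\{1,\dots,p\}$, let $q=p-|A_0|$ be the number of groups outside $A_0$, and put $d_a=\max_kd_k$, $d_b=\min_kd_k$, $d=d_a/d_b$, $N_d=\sum_kd_k$. Assume: * (generalized sparsity) $\sum_{k\in A_0}\|\beta_k\|_2\le\eta_1$ for some $\eta_1\ge0$; * (sparse Riesz condition) for some integer $q^*\le p$ and numbers $0<c_*\le c^*<\infty$, $$c_*\,n\sum_{k\in A}\|\nu_k\|_2^2\le\Big\|\sum_{k\in A}X_k\nu_k\Big\|_2^2\le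 c^*\,n\sum_{k\in A}\|\nu_k\|_2^2$$ for all $A\subset\{1,\dots,p\}$ with $|A|=q^*$ and all $\nu_k\in\mathbb R^{d_k}$, $k\in A$. Put $\bar c=c^*/c_*$, $\eta_2=\max_{A\subset A_0}\|\sum_{k\in A}X_k\beta_k\|_2$ and, for $\lambda>0$, $$r_1(\lambda)=\Big(\frac{nc^*\sqrt{d_a}\,\eta_1}{\lambda d_bq}\Big)^{1/2},\quad r_2(\lambda)=\Big(\frac{nc^*\eta_2^2}{\lambda^2d_bq}\Big)^{1/2},\quad M_1(\lambda)=2+4r_1^2+4\sqrt{d\bar c}\,r_2+4d\bar c,\quad B_1(\lambda)=\Big(\frac{\lambda^2d_b^2q}{nc^*}\Big)^{1/2}.$$ Let $c_0\ge0$ be a constant and let $a_n\ge0$ be such that $p\,d_a/(N_d\vee a_n)^{1+c_0}\to0$. Let $$\lambda_{n,p}=2\sigma\sqrt{8(1+c_0)d_ad^2q^*\bar c\,nc^*\log(N_d\vee a_n)},\qquad \lambda_0=\inf\{\lambda>0:M_1(\lambda)q+1\le q^*\}\quad(\inf\varnothing=\infty),$$ and assume $\lambda\ge\max\{\lambda_0,\lambda_{n,p}\}$.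 **Theorem.** Let $\bar c,\sigma,r_1=r_1(\lambda),r_2=r_2(\lambda),c_0,d$ be fixed (the same for all models of the sequence), and let $1\le q\le n\le p\to\infty$. Then, with probability converging to $1$, every group Lasso estimate $\hat\beta$ satisfies both $$\|\hat\beta-\beta\|_2\le\frac1{\sqrt{nc_*}}\Big(2\sigma\sqrt{M_1q\log N_d}+\big(r_2+\sqrt{dM_1\bar c}\big)B_1\Big)+\sqrt{\frac{c_*r_1^2+r_2^2}{c_*c^*}}\;\frac{\sqrt q\,\lambda}{n}$$ and $$\|X\hat\beta-X\beta\|_2\le2\sigma\sqrt{M_1q\log N_d}+\big(2r_2+\sqrt{dM_1\bar c}\big)B_1 .$$ -/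

import Mathlib

open scoped Matrix Topology
open Filter MeasureTheory ProbabilityTheory

noncomputable section

/-- The deterministic data of a linear regression model with `n` observations and `p` groups of
covariates: group sizes, design blocks `X_k`, the true coefficient `β = (β_1, …, β_p)`, the set
`A₀` of unimportant groups, the level `η₁` of generalized sparsity, and the rank and spectrum
bounds of the sparse Riesz condition. -/
structure GroupModel where
  n : ℕ
  p : ℕ
  dim : Fin p → ℕ
  X : (k : Fin p) → Matrix (Fin n) (Fin (dim k)) ℝ
  β : PiLp 2 (fun k : Fin p => EuclideanSpace ℝ (Fin (dim k)))
  A₀ : Finset (Fin p)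
  η₁ : ℝ
  qstar : ℕ
  cLow : ℝ
  cUp : ℝ

namespace GroupModel

/-- Coefficient vectors, partitioned into groups, with the `ℓ²` norm. -/
abbrev Coef (m : GroupModel) : Type :=
  PiLp 2 (fun k : Fin m.p => EuclideanSpace ℝ (Fin (m.dim k)))

/-- `X_A v_A = ∑_{k ∈ A} X_k v_k`. -/
def fitOn (m : GroupModel) (A : Finset (Fin m.p)) (v : m.Coef) : EuclideanSpace ℝ (Fin m.n) :=
  ∑ k ∈ A, WithLp.toLp 2 (m.X k *ᵥ (v k).ofLp)

/-- `X v`. -/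
def fit (m : GroupModel) (v : m.Coef) : EuclideanSpace ℝ (Fin m.n) :=
  m.fitOn Finset.univ v

/-- The group Lasso criterion with penalty level `l` and response `y`. -/
def criterion (m : GroupModel) (l : ℝ) (y : EuclideanSpace ℝ (Fin m.n)) (b : m.Coef) : ℝ :=
  1 / 2 * ‖y - m.fit b‖ ^ 2 + l * ∑ k, √(m.dim k : ℝ) * ‖b k‖

/-- `b` is a group Lasso estimate, i.e. a global minimizer of the criterion. -/
def IsGroupLasso (m : GroupModel) (l : ℝ) (y : EuclideanSpace ℝ (Fin m.n)) (b : m.Coef) : Prop :=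
  ∀ b' : m.Coef, m.criterion l y b ≤ m.criterion l y b'

/-- The number `q` of important groups. -/
def q (m : GroupModel) : ℕ := m.A₀ᶜ.card

/-- The largest group size `d_a`. -/
def da (m : GroupModel) : ℕ := ⨆ k, m.dim k

/-- The smallest group size `d_b`. -/
def db (m : GroupModel) : ℕ := ⨅ k, m.dim k

/-- `d = d_a / d_b`. -/
def d (m : GroupModel) : ℝ := (m.da : ℝ) / m.db

/-- The total number of covariates `N_d`. -/
def Nd (m : GroupModel) : ℕ := ∑ k, m.dim k

/-- `c̄ = c^* / c_*`. -/
def cbar (m : GroupModel) : ℝ := m.cUp / m.cLow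

/-- Generalized sparsity condition. -/
def GSC (m : GroupModel) : Prop := 0 ≤ m.η₁ ∧ ∑ k ∈ m.A₀, ‖m.β k‖ ≤ m.η₁

/-- Sparse Riesz condition with rank `q^*` and spectrum bounds `c_*`, `c^*`. The rank is at
most the number of groups, so that there are sets of `q^*` groups. -/
def SRC (m : GroupModel) : Prop :=
  m.qstar ≤ m.p ∧ 0 < m.cLow ∧ m.cLow ≤ m.cUp ∧
    ∀ A : Finset (Fin m.p), A.card = m.qstar → ∀ v : m.Coef,
      m.cLow * (m.n * ∑ k ∈ A, ‖v k‖ ^ 2) ≤ ‖m.fitOn A v‖ ^ 2 ∧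
      ‖m.fitOn A v‖ ^ 2 ≤ m.cUp * (m.n * ∑ k ∈ A, ‖v k‖ ^ 2)

/-- `η₂ = max_{A ⊆ A₀} ‖∑_{k ∈ A} X_k β_k‖`. -/
def η₂ (m : GroupModel) : ℝ :=
  m.A₀.powerset.sup' ⟨∅, Finset.empty_mem_powerset _⟩ (fun A => ‖m.fitOn A m.β‖)

/-- `r₁(λ)`. -/
def r₁ (m : GroupModel) (l : ℝ) : ℝ :=
  √((m.n * m.cUp * √(m.da : ℝ) * m.η₁) / (l * m.db * m.q))

/-- `r₂(λ)`. -/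
def r₂ (m : GroupModel) (l : ℝ) : ℝ :=
  √((m.n * m.cUp * m.η₂ ^ 2) / (l ^ 2 * m.db * m.q))

/-- `M₁(λ)`. -/
def M₁ (m : GroupModel) (l : ℝ) : ℝ :=
  2 + 4 * m.r₁ l ^ 2 + 4 * √(m.d * m.cbar) * m.r₂ l + 4 * m.d * m.cbar

/-- `B₁(λ)`. -/
def B₁ (m : GroupModel) (l : ℝ) : ℝ :=
  √((l ^ 2 * (m.db : ℝ) ^ 2 * m.q) / (m.n * m.cUp))

/-- `λ_{n,p}`, with noise level `σ`, constant `c₀` and auxiliary number `a = a_n`. -/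
def lamNP (m : GroupModel) (σ c₀ a : ℝ) : ℝ :=
  2 * σ * √(8 * (1 + c₀) * m.da * m.d ^ 2 * m.qstar * m.cbar * m.n * m.cUp *
    Real.log (max (m.Nd : ℝ) a))

/-- `λ₀ = inf {λ : M₁(λ) q + 1 ≤ q^*}`, over positive `λ` because `M₁(λ)` divides by `λ`;
the infimum in the extended reals is `∞` if there is no such `λ`. -/
def lamZero (m : GroupModel) : EReal :=
  sInf ((fun l : ℝ => (l : EReal)) '' {l : ℝ | 0 < l ∧ m.M₁ l * m.q + 1 ≤ m.qstar})

/-- The response `Y = X β + ε`. -/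
def response (m : GroupModel) (e : Fin m.n → ℝ) : EuclideanSpace ℝ (Fin m.n) :=
  m.fit m.β + WithLp.toLp 2 e

/-- The claimed bound on the estimation error `‖β̂ - β‖₂`. -/
def estBound (m : GroupModel) (σ l : ℝ) : ℝ :=
  1 / √(m.n * m.cLow) *
      (2 * σ * √(m.M₁ l * Real.log m.Nd * m.q) +
        (m.r₂ l + √(m.d * m.M₁ l * m.cbar)) * m.B₁ l) +
    √((m.cLow * m.r₁ l ^ 2 + m.r₂ l ^ 2) / (m.cLow * m.cUp)) * (√(m.q : ℝ) * l / m.n)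

/-- The claimed bound on the prediction error `‖X β̂ - X β‖₂`. -/
def predBound (m : GroupModel) (σ l : ℝ) : ℝ :=
  2 * σ * √(m.M₁ l * Real.log m.Nd * m.q) +
    (2 * m.r₂ l + √(m.d * m.M₁ l * m.cbar)) * m.B₁ l

end GroupModel

end

/-! Write `h` for the error `b - β` and `Q v = ‖X v‖² - n c_* ‖v‖²`. Three facts combine. Cone: when
every column of `X` has inner product at most `λ / 10` with the noise, optimality of `b` against `β`
bounds `‖X h‖²` plus the penalty of `h` on `A₀` by the penalty of `h` on the `q` important groups
plus a multiple of `λ √d_a η₁` (`IsGroupLasso.cone`). Restricted eigenvalue: `Q` is nonnegative on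
vectors supported on `q^*` groups. Replacing the `A₀` part of `h` by an average of single-group
vectors (Maurey) shows that `Q h` is at least a negative multiple of `(∑_{A₀} ‖h_k‖)² / (q^* - q -
1)` (`SRC.restricted_eigenvalue`). Since `λ ≥ λ₀` gives `q^* ≥ M₁ q + 1`, that denominator is at
least `(M₁ - 1) q`. Scaled by `√(λ² d_b q / (n c^*))`, the two become scalar inequalities that force
`‖X h‖` and `√(n c_*) ‖h‖` below `√(d M₁ c̄) B₁` (`sq_le_of_restricted_eigenvalue_of_cone`). The
other terms of both bounds are nonnegative. Noise: a Gaussian tail and a union bound over at most `p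
d_a` columns leave failure probability `2 p d_a / (N_d ∨ a_n)^(1 + c₀)`, which tends to `0`; the
threshold is at most `λ_{n,p} / 10`. -/

noncomputable section

/-! ### Norm identities and restriction to groups -/

/-- Bias–variance decomposition for a finitely supported random vector. -/
lemma sum_weight_norm_add_sq {ι E : Type*} [NormedAddCommGroup E] [InnerProductSpace ℝ E]
    (s : Finset ι) (p : ι → ℝ) (z : ι → E) (hp : ∑ k ∈ s, p k = 1) (a : E) :
    ∑ k ∈ s, p k * ‖a + z k‖ ^ 2 =
      ‖a + ∑ k ∈ s, p k • z k‖ ^ 2 + ∑ k ∈ s, p k * ‖z k‖ ^ 2 - ‖∑ k ∈ s, p k • z k‖ ^ 2 := by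
  have h1 : ∑ k ∈ s, p k * ‖a + z k‖ ^ 2 =
      (∑ k ∈ s, p k) * ‖a‖ ^ 2 + 2 * inner ℝ a (∑ k ∈ s, p k • z k) +
        ∑ k ∈ s, p k * ‖z k‖ ^ 2 := by
    rw [inner_sum, Finset.mul_sum, Finset.sum_mul, ← Finset.sum_add_distrib,
      ← Finset.sum_add_distrib]
    refine Finset.sum_congr rfl fun k _ => ?_
    rw [norm_add_sq_real, inner_smul_right]
    ring
  rw [h1, hp, norm_add_sq_real a]
  ring

/-- Comparison of the `ℓ¹` norm with the `ℓ²` norm. -/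
lemma sum_abs_le_sqrt_mul_norm {d : ℕ} (x : EuclideanSpace ℝ (Fin d)) :
    ∑ j, |x j| ≤ √(d : ℝ) * ‖x‖ := by
  rw [EuclideanSpace.norm_eq, ← Real.sqrt_mul (Nat.cast_nonneg d)]
  refine Real.le_sqrt_of_sq_le ?_
  have := sq_sum_le_card_mul_sum_sq (s := (Finset.univ : Finset (Fin d))) (f := fun j => |x j|)
  simpa using this

namespace GroupModel

variable (m : GroupModel)

/-- The map `v ↦ X v` as a linear map. -/
def fitLin : m.Coef →ₗ[ℝ] EuclideanSpace ℝ (Fin m.n) where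
  toFun := m.fit
  map_add' u v := by
    simp [fit, fitOn, Matrix.mulVec_add, Finset.sum_add_distrib]
  map_smul' c v := by
    simp [fit, fitOn, Matrix.mulVec_smul, Finset.smul_sum]

@[simp] lemma fitLin_apply (v : m.Coef) : m.fitLin v = m.fit v := rfl

lemma fitOn_eq_fit {A : Finset (Fin m.p)} {v : m.Coef} (hv : ∀ k ∉ A, v k = 0) :
    m.fitOn A v = m.fit v := by
  refine Finset.sum_subset (Finset.subset_univ A) fun k _ hk => ?_
  rw [hv k hk]
  simp

/-- The restriction of a coefficient vector to the groups in `A`. -/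
def restrict (A : Finset (Fin m.p)) (v : m.Coef) : m.Coef :=
  WithLp.toLp 2 fun k => if k ∈ A then v k else 0

lemma restrict_apply (A : Finset (Fin m.p)) (v : m.Coef) (k : Fin m.p) :
    m.restrict A v k = if k ∈ A then v k else 0 := rfl

lemma norm_sq_eq (v : m.Coef) : ‖v‖ ^ 2 = ∑ k, ‖v k‖ ^ 2 :=
  PiLp.norm_sq_eq_of_L2 _ v

lemma norm_restrict_sq (A : Finset (Fin m.p)) (v : m.Coef) :
    ‖m.restrict A v‖ ^ 2 = ∑ k ∈ A, ‖v k‖ ^ 2 := by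
  rw [norm_sq_eq, ← Finset.sum_subset (Finset.subset_univ A)]
  · exact Finset.sum_congr rfl fun k hk => by rw [restrict_apply, if_pos hk]
  · intro k _ hk
    rw [restrict_apply, if_neg hk]
    simp

lemma sum_restrict_singleton (A : Finset (Fin m.p)) (v : m.Coef) :
    ∑ k ∈ A, m.restrict {k} v = m.restrict A v := by
  ext1 l
  rw [WithLp.ofLp_sum, Finset.sum_apply]
  simp only [restrict_apply, Finset.mem_singleton]
  rw [Finset.sum_ite_eq A l (fun _ => v l)]

lemma restrict_compl_add (A : Finset (Fin m.p)) (v : m.Coef) :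
    m.restrict Aᶜ v + m.restrict A v = v := by
  ext1 l
  rw [PiLp.add_apply, restrict_apply, restrict_apply]
  by_cases h : l ∈ A <;> simp [h]

/-! ### Sparse Riesz condition and Maurey's argument -/

variable {m}

/-- The spectrum bounds hold for vectors supported on at most `q^*` groups. -/
lemma SRC.bounds (h : m.SRC) {A : Finset (Fin m.p)} (hA : A.card ≤ m.qstar) {v : m.Coef}
    (hv : ∀ k ∉ A, v k = 0) :
    m.n * m.cLow * ‖v‖ ^ 2 ≤ ‖m.fit v‖ ^ 2 ∧ ‖m.fit v‖ ^ 2 ≤ m.n * m.cUp * ‖v‖ ^ 2 := by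
  obtain ⟨hqp, -, -, hs⟩ := h
  obtain ⟨B, hAB, hB⟩ := Finset.exists_superset_card_eq hA (by simpa using hqp)
  have hvB : ∀ k ∉ B, v k = 0 := fun k hk => hv k fun hk' => hk (hAB hk')
  have h2 := hs B hB v
  have h3 : ∑ k ∈ B, ‖v k‖ ^ 2 = ‖v‖ ^ 2 := by
    rw [norm_sq_eq]
    exact Finset.sum_subset (Finset.subset_univ B) fun k _ hk => by rw [hvB k hk]; simp
  rw [h3, m.fitOn_eq_fit hvB] at h2
  constructor <;> nlinarith [h2.1, h2.2]

/-- Maurey's argument: a quadratic form that is nonnegative on sparse vectors is not too negative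
on convex combinations. -/
lemma SRC.maurey (h : m.SRC) (A : Finset (Fin m.p)) (p : Fin m.p → ℝ) (z : Fin m.p → m.Coef)
    (hp0 : ∀ k ∈ A, 0 ≤ p k) (hp : ∑ k ∈ A, p k = 1) (hz : ∀ k, ∀ l ≠ k, z k l = 0)
    (w : m.Coef) (hw : w = ∑ k ∈ A, p k • z k) (j : ℕ) :
    ∀ (S : Finset (Fin m.p)) (u : m.Coef), S.card + j ≤ m.qstar → (∀ k ∉ S, u k = 0) →
      -(j * (∑ k ∈ A, p k * (‖m.fit (z k)‖ ^ 2 - m.n * m.cLow * ‖z k‖ ^ 2) -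
        (‖m.fit w‖ ^ 2 - m.n * m.cLow * ‖w‖ ^ 2))) ≤
      ‖m.fit (u + (j : ℝ) • w)‖ ^ 2 - m.n * m.cLow * ‖u + (j : ℝ) • w‖ ^ 2 := by
  induction j with
  | zero =>
    intro S u hS hu
    have := (h.bounds (by simpa using hS) hu).1
    simp
    linarith
  | succ j ih =>
    intro S u hS hu
    -- The variance of `Q` under the law `p` on the `z k`: by bias–variance, `Q (u + (j + 1) w) = ∑
    -- p k * Q (u + j w + z k) - R`.
    set R := ∑ k ∈ A, p k * (‖m.fit (z k)‖ ^ 2 - m.n * m.cLow * ‖z k‖ ^ 2) -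
        (‖m.fit w‖ ^ 2 - m.n * m.cLow * ‖w‖ ^ 2) with hR
    have key : ∀ k ∈ A, -(j * R) ≤ ‖m.fit (u + (j : ℝ) • w + z k)‖ ^ 2 -
        m.n * m.cLow * ‖u + (j : ℝ) • w + z k‖ ^ 2 := by
      intro k _
      -- One copy of `w` is traded for `z k`, which enlarges the support by at most one group, so
      -- `S.card + j` stays within budget.
      have := ih (insert k S) (u + z k) (by
        have := Finset.card_insert_le k S
        omega) (by
        intro l hl
        rw [Finset.mem_insert, not_or] at hl
        rw [PiLp.add_apply, hu l hl.2, hz k l hl.1, add_zero])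
      rwa [add_right_comm] at this
    have h1 : -(j * R) ≤ ∑ k ∈ A, p k * (‖m.fit (u + (j : ℝ) • w + z k)‖ ^ 2 -
        m.n * m.cLow * ‖u + (j : ℝ) • w + z k‖ ^ 2) := by
      calc -(j * R) = ∑ k ∈ A, p k * -(j * R) := by rw [← Finset.sum_mul, hp, one_mul]
        _ ≤ _ := Finset.sum_le_sum fun k hk => mul_le_mul_of_nonneg_left (key k hk) (hp0 k hk)
    have h2 := sum_weight_norm_add_sq A p z hp (u + (j : ℝ) • w)
    have h3 := sum_weight_norm_add_sq A p (fun k => m.fitLin (z k)) hp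
      (m.fitLin (u + (j : ℝ) • w))
    have h4 : ∑ k ∈ A, p k • m.fitLin (z k) = m.fitLin w := by
      rw [hw, map_sum]
      exact Finset.sum_congr rfl fun k _ => (m.fitLin.map_smul _ _).symm
    have h5 : u + ((j + 1 : ℕ) : ℝ) • w = u + (j : ℝ) • w + w := by
      push_cast
      rw [add_smul, one_smul, add_assoc]
    rw [h4] at h3
    simp only [← map_add] at h3
    simp only [fitLin_apply] at h3
    rw [← hw] at h2
    rw [h5]
    simp only [mul_sub, Finset.sum_sub_distrib] at h1 hR
    have h6 : ∀ f : Fin m.p → ℝ, ∑ k ∈ A, p k * (m.n * m.cLow * f k) =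
        m.n * m.cLow * ∑ k ∈ A, p k * f k := fun f => by
      rw [Finset.mul_sum]
      exact Finset.sum_congr rfl fun k _ => by ring
    rw [h6] at h1 hR
    rw [h2, h3] at h1
    push_cast
    linarith [hR]

/-- Restricted eigenvalue inequality, without loss in the leading term: outside of `A` the vector
may be arbitrary. -/
lemma SRC.restricted_eigenvalue (h : m.SRC) (A : Finset (Fin m.p)) (j : ℕ) (hj : 2 ≤ j)
    (hA : Aᶜ.card + j ≤ m.qstar) (v : m.Coef) :
    m.n * m.cLow * ‖v‖ ^ 2 ≤ ‖m.fit v‖ ^ 2 +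
      m.n * (m.cUp - m.cLow) * (∑ k ∈ A, ‖v k‖) ^ 2 / (j - 1) := by
  set s := ∑ k ∈ A, ‖v k‖ with hs
  have hj' : (2 : ℝ) ≤ j := by exact_mod_cast hj
  have hs0 : 0 ≤ s := Finset.sum_nonneg fun k _ => norm_nonneg _
  have hn : (0 : ℝ) ≤ m.n := Nat.cast_nonneg _
  have hsup : ∀ (B : Finset (Fin m.p)), ∀ k ∉ B, m.restrict B v k = 0 := fun B k hk => by
    rw [restrict_apply, if_neg hk]
  have hdec := m.restrict_compl_add A v
  rcases hs0.eq_or_lt with h0 | hpos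
  · have hzero : m.restrict A v = 0 := by
      rw [← norm_eq_zero, ← sq_eq_zero_iff, norm_restrict_sq]
      refine Finset.sum_eq_zero fun k hk => ?_
      have := (Finset.sum_eq_zero_iff_of_nonneg (fun k _ => norm_nonneg (v k))).1
        (hs.symm.trans h0.symm) k hk
      rw [this]; norm_num
    rw [hzero, add_zero] at hdec
    have hb := (h.bounds (A := Aᶜ) (by omega) (hsup Aᶜ)).1
    rw [hdec] at hb
    rw [← h0]
    simpa using hb
  · set Q : m.Coef → ℝ := fun x => ‖m.fit x‖ ^ 2 - m.n * m.cLow * ‖x‖ ^ 2 with hQ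
    have hQs : ∀ (c : ℝ) x, Q (c • x) = c ^ 2 * Q x := fun c x => by
      have : m.fit (c • x) = c • m.fit x := m.fitLin.map_smul c x
      simp only [hQ, this, norm_smul, mul_pow, Real.norm_eq_abs, sq_abs]
      ring
    set w := (1 / (j : ℝ)) • m.restrict A v with hw
    have hjw : (j : ℝ) • w = m.restrict A v := by
      rw [hw, smul_smul, mul_one_div_cancel (by positivity), one_smul]
    -- Weights proportional to `‖v k‖` give every atom with `v k ≠ 0` the same norm `s / j`; groups
    -- with `v k = 0` have weight and atom zero.
    have hwsum : w = ∑ k ∈ A, (‖v k‖ / s) • ((s / (j * ‖v k‖)) • m.restrict {k} v) := by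
      rw [hw, ← sum_restrict_singleton, Finset.smul_sum]
      refine Finset.sum_congr rfl fun k _ => ?_
      rcases eq_or_ne (‖v k‖) 0 with hk | hk
      · have : m.restrict {k} v = 0 := by
          rw [← norm_eq_zero, ← sq_eq_zero_iff, norm_restrict_sq]
          simp [hk]
        simp [this]
      · rw [smul_smul]
        congr 1
        field_simp
    have hM := h.maurey A (fun k => ‖v k‖ / s) (fun k => (s / (j * ‖v k‖)) • m.restrict {k} v)
      (fun k _ => by positivity) (by rw [← Finset.sum_div, ← hs, div_self hpos.ne'])
      (fun k l hl => by simp [restrict_apply, hl]) w hwsum j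
    set R := ∑ k ∈ A, ‖v k‖ / s * Q ((s / (j * ‖v k‖)) • m.restrict {k} v) with hR
    have hRle : R ≤ m.n * (m.cUp - m.cLow) * s ^ 2 / j ^ 2 := by
      have : ∀ k ∈ A, ‖v k‖ / s * Q ((s / (j * ‖v k‖)) • m.restrict {k} v) ≤
          ‖v k‖ * (m.n * (m.cUp - m.cLow) * s / j ^ 2) := by
        intro k _
        rw [hQs]
        have hb := (h.bounds (A := {k}) (by rw [Finset.card_singleton]; omega) (hsup {k})).2
        rw [norm_restrict_sq, Finset.sum_singleton] at hb
        have hq : Q (m.restrict {k} v) ≤ m.n * (m.cUp - m.cLow) * ‖v k‖ ^ 2 := by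
          simp only [hQ, norm_restrict_sq, Finset.sum_singleton]
          linarith
        rcases (norm_nonneg (v k)).eq_or_lt with hk | hk
        · rw [← hk]; simp
        calc _ ≤ ‖v k‖ / s * ((s / (j * ‖v k‖)) ^ 2 *
              (m.n * (m.cUp - m.cLow) * ‖v k‖ ^ 2)) := by gcongr
          _ = _ := by field_simp
      calc R ≤ ∑ k ∈ A, ‖v k‖ * (m.n * (m.cUp - m.cLow) * s / j ^ 2) := Finset.sum_le_sum this
        _ = _ := by rw [← Finset.sum_mul, ← hs]; ring
    have hQw : Q w = 1 / (j : ℝ) ^ 2 * Q (m.restrict A v) := by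
      rw [hw, hQs]; ring
    -- Maurey's bound is used twice: here for `v` itself, then with empty support for its `A` part
    -- alone, which bounds the leftover `QA / j`.
    have h1 : -(j * (R - Q w)) ≤ Q (m.restrict Aᶜ v + (j : ℝ) • w) := hM Aᶜ _ hA (hsup Aᶜ)
    have h2 : -(j * (R - Q w)) ≤ Q (0 + (j : ℝ) • w) := hM ∅ 0 (by simp; omega) (by simp)
    rw [hjw, hdec] at h1
    rw [hjw, zero_add] at h2
    rw [hQw] at h1 h2
    set e := m.n * (m.cUp - m.cLow) * s ^ 2 with he
    set QA := Q (m.restrict A v) with hQA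
    have h3 : j * R ≤ e / j := by
      calc j * R ≤ j * (e / j ^ 2) := by gcongr
        _ = e / j := by field_simp
    have h4 : (j : ℝ) * (1 / j ^ 2 * QA) = QA / j := by field_simp
    rw [mul_sub, h4] at h1 h2
    have hj1 : (0 : ℝ) < j - 1 := by linarith
    have h5 : -(e / (j - 1)) ≤ QA := by
      have : -e ≤ QA * (j - 1) := by
        have h2' : -(e / j) ≤ QA - QA / j := by linarith
        have := mul_le_mul_of_nonneg_right h2' (by linarith : (0 : ℝ) ≤ j)
        have e1 : -(e / j) * j = -e := by field_simp
        have e2 : (QA - QA / j) * j = QA * (j - 1) := by field_simp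
        linarith
      rw [← neg_div, div_le_iff₀ hj1]
      exact this
    have h6 : -(e / (j - 1)) / j ≤ QA / j := by gcongr
    -- The two losses add up to exactly `e / (j - 1)`.
    have h7 : e / j + e / (j - 1) / j = e / (j - 1) := by
      field_simp
      ring
    have h8 : -(e / (j - 1)) / j = -(e / (j - 1) / j) := neg_div _ _
    have h9 : Q v = ‖m.fit v‖ ^ 2 - m.n * m.cLow * ‖v‖ ^ 2 := rfl
    linarith

/-! ### Optimality of the estimate and the noise term -/

/-- The weighted group penalty over the groups in `A`. -/
def pen (m : GroupModel) (A : Finset (Fin m.p)) (v : m.Coef) : ℝ :=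
  ∑ k ∈ A, √(m.dim k : ℝ) * ‖v k‖

/-- The variational inequality characterising group Lasso estimates. -/
lemma IsGroupLasso.inner_le {l : ℝ} (hl : 0 ≤ l) {y : EuclideanSpace ℝ (Fin m.n)} {b : m.Coef}
    (hb : m.IsGroupLasso l y b) (c : m.Coef) :
    inner ℝ (y - m.fit b) (m.fit (c - b)) ≤
      l * (m.pen Finset.univ c - m.pen Finset.univ b) := by
  set r := y - m.fit b with hr
  set f := m.fit (c - b) with hf
  set D := l * (m.pen Finset.univ c - m.pen Finset.univ b) with hD
  -- Compare `b` with `b + t (c - b)`: the penalty is convex, and the quadratic remainder vanishes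
  -- after division by `t → 0`.
  have key : ∀ t ∈ Set.Ioc (0 : ℝ) 1, inner ℝ r f ≤ D + t * (‖f‖ ^ 2 / 2) := by
    rintro t ⟨ht0, ht1⟩
    have h1 := hb (b + t • (c - b))
    have h2 : m.fit (b + t • (c - b)) = m.fit b + t • f := by
      rw [hf, ← fitLin_apply, map_add, map_smul]; rfl
    have h3 : m.pen Finset.univ (b + t • (c - b)) ≤
        m.pen Finset.univ b + t * (m.pen Finset.univ c - m.pen Finset.univ b) := by
      simp only [pen, ← Finset.sum_sub_distrib, Finset.mul_sum, ← Finset.sum_add_distrib]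
      refine Finset.sum_le_sum fun k _ => ?_
      have h4 : ‖(b + t • (c - b)) k‖ ≤ (1 - t) * ‖b k‖ + t * ‖c k‖ := by
        have : (b + t • (c - b)) k = (1 - t) • b k + t • c k := by
          rw [PiLp.add_apply, PiLp.smul_apply, PiLp.sub_apply]
          module
        rw [this]
        refine (norm_add_le _ _).trans_eq ?_
        rw [norm_smul, norm_smul, Real.norm_of_nonneg (by linarith), Real.norm_of_nonneg ht0.le]
      calc _ ≤ √(m.dim k : ℝ) * ((1 - t) * ‖b k‖ + t * ‖c k‖) := by gcongr
        _ = _ := by ring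
    simp only [criterion] at h1
    rw [h2, ← sub_sub, ← hr, norm_sub_sq_real r, inner_smul_right, norm_smul, mul_pow,
      Real.norm_eq_abs, sq_abs] at h1
    have h5 := mul_le_mul_of_nonneg_left h3 hl
    simp only [pen] at h5 hD
    have h6 : t * inner ℝ r f ≤ t * (D + t * (‖f‖ ^ 2 / 2)) := by
      rw [hD]; nlinarith [h5, h1]
    exact le_of_mul_le_mul_left h6 ht0
  have hlim : Tendsto (fun t : ℝ => D + t * (‖f‖ ^ 2 / 2)) (𝓝[>] 0) (𝓝 (D + 0 * (‖f‖ ^ 2 / 2))) :=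
    (Continuous.tendsto (by fun_prop) 0).mono_left nhdsWithin_le_nhds
  rw [zero_mul, add_zero] at hlim
  exact ge_of_tendsto hlim (mem_of_superset (Ioc_mem_nhdsGT one_pos) key)

/-- `⟨ε, X v⟩` is controlled by the penalty of `v` when the columns are almost orthogonal
to `ε`. -/
lemma inner_fit_le {t : ℝ} {e : Fin m.n → ℝ}
    (he : ∀ k j, |∑ i, m.X k i j * e i| ≤ t) (v : m.Coef) :
    inner ℝ (WithLp.toLp 2 e : EuclideanSpace ℝ (Fin m.n)) (m.fit v) ≤
      t * m.pen Finset.univ v := by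
  rw [fit, fitOn, inner_sum, pen, Finset.mul_sum]
  refine Finset.sum_le_sum fun k _ => ?_
  have h1 : inner ℝ (WithLp.toLp 2 e : EuclideanSpace ℝ (Fin m.n))
      (WithLp.toLp 2 (m.X k *ᵥ (v k).ofLp)) = ∑ j, (∑ i, m.X k i j * e i) * v k j := by
    simp only [PiLp.inner_apply, Matrix.mulVec, dotProduct, RCLike.inner_apply, conj_trivial,
      Finset.sum_mul]
    rw [Finset.sum_comm]
    exact Finset.sum_congr rfl fun j _ => Finset.sum_congr rfl fun i _ => by ring
  rw [h1]
  -- A group without columns does not force `0 ≤ t`, but contributes nothing.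
  rcases isEmpty_or_nonempty (Fin (m.dim k)) with hemp | ⟨⟨j₀⟩⟩
  · have : m.dim k = 0 := Nat.eq_zero_of_not_pos fun h => hemp.false ⟨0, h⟩
    simp [this]
  have ht : 0 ≤ t := (abs_nonneg _).trans (he k j₀)
  calc ∑ j, (∑ i, m.X k i j * e i) * v k j ≤ ∑ j, t * |v k j| := by
        refine Finset.sum_le_sum fun j _ => ?_
        refine (le_abs_self _).trans ?_
        rw [abs_mul]
        exact mul_le_mul_of_nonneg_right (he k j) (abs_nonneg _)
    _ = t * ∑ j, |v k j| := (Finset.mul_sum _ _ _).symm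
    _ ≤ _ := mul_le_mul_of_nonneg_left (sum_abs_le_sqrt_mul_norm _) ht

end GroupModel
end

/-! ### From the cone condition to error bounds -/

noncomputable section

/-- The scalar inequalities that turn a restricted eigenvalue inequality and a cone condition, both
in normalised form, into error bounds. -/
lemma sq_le_of_restricted_eigenvalue_of_cone {x y w D K ρ : ℝ} (hy : 0 ≤ y) (hw : 0 ≤ w)
    (hD : 1 ≤ D) (hρ : 0 ≤ ρ) (hK : 2 + 4 * D + 2 * ρ ≤ K)
    (h1 : y ^ 2 ≤ x ^ 2 + w ^ 2 / (K - 1))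
    (h2 : x ^ 2 + 9 / 10 * w ≤ 11 / 10 * √D * y + ρ) :
    x ^ 2 ≤ D * K ∧ y ^ 2 ≤ D * K := by
  obtain ⟨a, ha1, rfl⟩ : ∃ a : ℝ, 1 ≤ a ∧ D = a ^ 2 :=
    ⟨√D, Real.one_le_sqrt.2 hD, (Real.sq_sqrt (by linarith)).symm⟩
  obtain ⟨g, hg0, rfl⟩ : ∃ g : ℝ, 0 ≤ g ∧ K = g ^ 2 :=
    ⟨√K, Real.sqrt_nonneg _, (Real.sq_sqrt (by linarith)).symm⟩
  rw [Real.sqrt_sq (by linarith)] at h2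
  have ha2 : 1 ≤ a ^ 2 := by nlinarith
  -- From `K ≥ 6`; chosen so that `11/10 ≤ 9/20 * g`, which absorbs the linear term in `y`.
  have hg2 : 22 / 9 ≤ g := by nlinarith
  have hag : 2 * a ≤ g := by nlinarith
  have hg6 : 6 ≤ g ^ 2 := by linarith
  have hgy : ∀ {z : ℝ}, 0 ≤ z → z ^ 2 ≤ a ^ 2 * g ^ 2 → z ≤ a * g := fun hz h => by
    rw [← mul_pow] at h
    exact le_of_sq_le_sq h (by positivity)
  have hyag : y ^ 2 ≤ a ^ 2 * g ^ 2 := by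
    by_contra! hlt
    have hay : a * g < y := by
      rw [← mul_pow] at hlt
      exact lt_of_pow_lt_pow_left₀ 2 hy hlt
    set T := 11 / 10 * a * y + ρ with hT
    have hT0 : 0 ≤ T := by positivity
    have hwT : w ≤ 10 / 9 * T := by nlinarith [sq_nonneg x]
    have hK1 : 0 < g ^ 2 - 1 := by linarith
    -- One factor of `w²` is replaced by its upper bound, so the right side is affine in `w` and
    -- only the endpoints `w = 0` and `w = 10/9 * T` matter.
    have h3 : y ^ 2 ≤ T + w * (10 / 9 * T / (g ^ 2 - 1) - 9 / 10) := by
      have : w ^ 2 / (g ^ 2 - 1) ≤ w * (10 / 9 * T / (g ^ 2 - 1)) := by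
        rw [pow_two, mul_div_assoc]
        gcongr
      linarith
    rcases le_total (10 / 9 * T / (g ^ 2 - 1) - 9 / 10) 0 with hneg | hpos
    · have h4 : y ^ 2 ≤ T := by nlinarith [mul_nonneg hw (neg_nonneg.2 hneg)]
      have h5 : 11 / 10 * a * y ≤ 9 / 20 * y ^ 2 := by nlinarith
      have h6 : g ^ 2 ≤ a ^ 2 * g ^ 2 := by nlinarith
      nlinarith
    · have h4 : y ^ 2 * (g ^ 2 - 1) ≤ (10 / 9 * T) ^ 2 := by
        have h5 := mul_le_mul_of_nonneg_right hwT hpos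
        have h6 : T + 10 / 9 * T * (10 / 9 * T / (g ^ 2 - 1) - 9 / 10) =
            (10 / 9 * T) ^ 2 / (g ^ 2 - 1) := by
          field_simp
          ring
        rw [← le_div_iff₀ hK1]
        linarith
      -- `K ≥ 6` gives `K - 1 ≥ 81/100 * K`.
      have h5 : (9 / 10 * g * y) ^ 2 ≤ (10 / 9 * T) ^ 2 := by
        refine le_trans ?_ h4
        have := sq_nonneg y
        nlinarith
      have h6 : 9 / 10 * g * y ≤ 10 / 9 * T := le_of_sq_le_sq h5 (by positivity)
      have h7 : (81 / 100 * g - 11 / 10 * a) * y ≤ ρ := by linarith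
      have h8 : (81 / 100 * g - 11 / 10 * a) * g ≤ ρ := by
        refine le_trans (mul_le_mul_of_nonneg_left ?_ (by linarith)) h7
        nlinarith
      -- With `2ρ ≤ g² - 2 - 4a²`, `h8` would give `31/100 g² - 11/10 a g + 2a² + 1 ≤ 0`, whose
      -- quadratic part is positive definite.
      nlinarith [sq_nonneg (g - 2 * a)]
  refine ⟨?_, hyag⟩
  have hy' := hgy hy hyag
  have h3 : 11 / 10 * a * y ≤ a ^ 2 * g ^ 2 / 2 := by
    have : 11 / 10 * a * y ≤ 11 / 10 * a * (a * g) := by gcongr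
    nlinarith [mul_nonneg (sq_nonneg a) hg0]
  nlinarith

namespace GroupModel

variable {m : GroupModel}

lemma dim_le_da (k : Fin m.p) : m.dim k ≤ m.da :=
  le_ciSup (Set.finite_range m.dim).bddAbove k

lemma db_le_dim (k : Fin m.p) : m.db ≤ m.dim k :=
  ciInf_le (OrderBot.bddBelow _) k

lemma db_pos (hdim : ∀ k, 0 < m.dim k) (hq : 1 ≤ m.q) : 0 < m.db := by
  obtain ⟨k, -⟩ := Finset.card_pos.1 hq
  have : Nonempty (Fin m.p) := ⟨k⟩
  exact le_ciInf (f := m.dim) hdim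

lemma db_le_da (hq : 1 ≤ m.q) : m.db ≤ m.da := by
  obtain ⟨k, -⟩ := Finset.card_pos.1 hq
  exact (db_le_dim k).trans (dim_le_da k)

lemma one_le_d (hdim : ∀ k, 0 < m.dim k) (hq : 1 ≤ m.q) : 1 ≤ m.d := by
  have h : (0 : ℝ) < m.db := by exact_mod_cast db_pos hdim hq
  rw [d, one_le_div h]
  exact_mod_cast db_le_da hq

lemma SRC.one_le_cbar (h : m.SRC) : 1 ≤ m.cbar := by
  rw [cbar, one_le_div h.2.1]
  exact h.2.2.1

lemma SRC.cUp_pos (h : m.SRC) : 0 < m.cUp := h.2.1.trans_le h.2.2.1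

/-- With `D = d c̄` and `ρ = 2 r₁²`, this is the lower bound on `K = M₁` that the scalar
inequalities require. -/
lemma two_add_le_M₁ (l : ℝ) :
    2 + 4 * (m.d * m.cbar) + 4 * m.r₁ l ^ 2 ≤ m.M₁ l := by
  have h1 : 0 ≤ √(m.d * m.cbar) * m.r₂ l := mul_nonneg (Real.sqrt_nonneg _) (Real.sqrt_nonneg _)
  rw [M₁]
  nlinarith

/-- Cone condition for the error of a group Lasso estimate. -/
lemma IsGroupLasso.cone {l t : ℝ} (hl : 0 < l) (ht : t ≤ l / 10) (hG : m.GSC)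
    {e : Fin m.n → ℝ} (he : ∀ k j, |∑ i, m.X k i j * e i| ≤ t) {b : m.Coef}
    (hb : m.IsGroupLasso l (m.response e) b) :
    ‖m.fit (b - m.β)‖ ^ 2 + 9 / 10 * (l * m.pen m.A₀ (b - m.β)) ≤
      11 / 10 * (l * m.pen m.A₀ᶜ (b - m.β)) + 2 * (l * (√(m.da : ℝ) * m.η₁)) := by
  set h := b - m.β with hh
  have h1 := hb.inner_le hl.le m.β
  have h2 := inner_fit_le he h
  have h3 : m.response e - m.fit b = WithLp.toLp 2 e - m.fit h := by
    have : m.fit h = m.fit b - m.fit m.β := m.fitLin.map_sub _ _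
    rw [response, this]
    abel
  have h4 : m.fit (m.β - b) = -m.fit h := by
    rw [← neg_sub, ← hh]
    exact m.fitLin.map_neg h
  rw [h3, h4, inner_neg_right, inner_sub_left, real_inner_self_eq_norm_sq] at h1
  have hsplit : ∀ v : m.Coef, m.pen Finset.univ v = m.pen m.A₀ v + m.pen m.A₀ᶜ v := fun v =>
    (Finset.sum_add_sum_compl m.A₀ _).symm
  have hpen0 : ∀ A, 0 ≤ m.pen A h := fun A => Finset.sum_nonneg fun k _ => by positivity
  have h5 : m.pen m.A₀ᶜ m.β - m.pen m.A₀ᶜ b ≤ m.pen m.A₀ᶜ h := by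
    rw [pen, pen, pen, ← Finset.sum_sub_distrib]
    refine Finset.sum_le_sum fun k _ => ?_
    rw [← mul_sub]
    refine mul_le_mul_of_nonneg_left ?_ (Real.sqrt_nonneg _)
    rw [hh, PiLp.sub_apply, norm_sub_rev]
    exact norm_sub_norm_le _ _
  -- On `A₀` the estimate is bounded below through `h`, so the small penalty of `β` is paid twice.
  have h6 : m.pen m.A₀ m.β - m.pen m.A₀ b ≤ 2 * m.pen m.A₀ m.β - m.pen m.A₀ h := by
    rw [pen, pen, pen, ← Finset.sum_sub_distrib, Finset.mul_sum, ← Finset.sum_sub_distrib]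
    refine Finset.sum_le_sum fun k _ => ?_
    have : ‖h k‖ ≤ ‖b k‖ + ‖m.β k‖ := by
      rw [hh, PiLp.sub_apply]
      exact norm_sub_le _ _
    nlinarith [Real.sqrt_nonneg (m.dim k : ℝ)]
  have h7 : m.pen m.A₀ m.β ≤ √(m.da : ℝ) * m.η₁ := by
    refine le_trans ?_ (mul_le_mul_of_nonneg_left hG.2 (Real.sqrt_nonneg _))
    rw [pen, Finset.mul_sum]
    refine Finset.sum_le_sum fun k _ => ?_
    have : (m.dim k : ℝ) ≤ m.da := by exact_mod_cast dim_le_da k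
    gcongr
  have h8 : m.pen Finset.univ m.β - m.pen Finset.univ b ≤
      m.pen m.A₀ᶜ h - m.pen m.A₀ h + 2 * (√(m.da : ℝ) * m.η₁) := by
    rw [hsplit, hsplit]
    linarith
  have h9 := mul_le_mul_of_nonneg_left h8 hl.le
  have h10 : t * m.pen Finset.univ h ≤ l / 10 * (m.pen m.A₀ h + m.pen m.A₀ᶜ h) := by
    rw [hsplit]
    exact mul_le_mul_of_nonneg_right ht (add_nonneg (hpen0 _) (hpen0 _))
  linarith

/-- Error bounds with the natural scale `√(λ² d_b q / (n c^*))` in place of `B₁`. -/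
lemma IsGroupLasso.scaled_error_le {l t : ℝ} (hl : 0 < l) (ht : t ≤ l / 10)
    (hn : 0 < m.n) (hq : 1 ≤ m.q) (hdim : ∀ k, 0 < m.dim k) (hG : m.GSC) (hS : m.SRC)
    (hM : m.M₁ l * m.q + 1 ≤ m.qstar)
    {e : Fin m.n → ℝ} (he : ∀ k j, |∑ i, m.X k i j * e i| ≤ t) {b : m.Coef}
    (hb : m.IsGroupLasso l (m.response e) b) :
    ‖m.fit (b - m.β)‖ ≤
        √(m.d * m.M₁ l * m.cbar) * √(l ^ 2 * m.db * m.q / (m.n * m.cUp)) ∧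
      √(m.n * m.cLow) * ‖b - m.β‖ ≤
        √(m.d * m.M₁ l * m.cbar) * √(l ^ 2 * m.db * m.q / (m.n * m.cUp)) := by
  have hcone := hb.cone hl ht hG he
  set h := b - m.β with hh
  have hn' : (0 : ℝ) < m.n := by exact_mod_cast hn
  have hq' : (1 : ℝ) ≤ m.q := by exact_mod_cast hq
  have hdb : (1 : ℝ) ≤ m.db := by exact_mod_cast db_pos hdim hq
  have hda : (1 : ℝ) ≤ m.da := hdb.trans (by exact_mod_cast db_le_da hq)
  have hU := hS.cUp_pos
  have hLo := hS.2.1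
  set D := m.d * m.cbar with hD
  have hD1 : 1 ≤ D := one_le_mul_of_one_le_of_one_le (one_le_d hdim hq) hS.one_le_cbar
  set K := m.M₁ l with hK
  have hKge := m.two_add_le_M₁ l
  set ρ := 2 * m.r₁ l ^ 2 with hρ
  have hρ' : ρ = 2 * ((m.n * m.cUp * √(m.da : ℝ) * m.η₁) / (l * m.db * m.q)) := by
    have := hG.1
    rw [hρ, r₁, Real.sq_sqrt (by positivity)]
  have hρ0 : 0 ≤ ρ := by positivity
  have hKD : 2 + 4 * D + 2 * ρ ≤ K := by rw [hρ]; linarith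
  set B := √(l ^ 2 * m.db * m.q / (m.n * m.cUp)) with hB
  have hB2 : B ^ 2 = l ^ 2 * m.db * m.q / (m.n * m.cUp) := Real.sq_sqrt (by positivity)
  have hBpos : 0 < B := Real.sqrt_pos.2 (by positivity)
  set s := ∑ k ∈ m.A₀, ‖h k‖ with hs
  have hs0 : 0 ≤ s := Finset.sum_nonneg fun k _ => norm_nonneg _
  -- the penalties against the norms
  have hpA : √(m.db : ℝ) * s ≤ m.pen m.A₀ h := by
    rw [hs, Finset.mul_sum, pen]
    refine Finset.sum_le_sum fun k _ => ?_
    have : (m.db : ℝ) ≤ m.dim k := by exact_mod_cast db_le_dim k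
    gcongr
  have hpS : m.pen m.A₀ᶜ h ≤ √(m.da : ℝ) * (√(m.q : ℝ) * ‖h‖) := by
    have h1 : m.pen m.A₀ᶜ h ≤ √(m.da : ℝ) * ∑ k ∈ m.A₀ᶜ, ‖h k‖ := by
      rw [Finset.mul_sum, pen]
      refine Finset.sum_le_sum fun k _ => ?_
      have : (m.dim k : ℝ) ≤ m.da := by exact_mod_cast dim_le_da k
      gcongr
    refine h1.trans (mul_le_mul_of_nonneg_left ?_ (Real.sqrt_nonneg _))
    refine le_of_sq_le_sq ?_ (by positivity)
    rw [mul_pow, Real.sq_sqrt (by positivity), norm_sq_eq]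
    refine sq_sum_le_card_mul_sum_sq.trans ?_
    rw [show (m.A₀ᶜ.card : ℝ) = m.q from rfl]
    gcongr
    exact Finset.subset_univ _
  -- restricted eigenvalue inequality
  obtain ⟨j, hj⟩ : ∃ j, m.qstar = m.q + j := by
    refine Nat.exists_eq_add_of_le ?_
    have : (m.q : ℝ) ≤ m.qstar := by nlinarith
    exact_mod_cast this
  have hjr : (m.qstar : ℝ) = m.q + j := by exact_mod_cast hj
  -- The `+ 1` in the rank condition pays for the `- 1` in the denominator `j - 1`.
  have hj1 : (K - 1) * m.q ≤ (j : ℝ) - 1 := by linarith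
  have hj2 : 2 ≤ j := by
    have : (2 : ℝ) ≤ j := by nlinarith
    exact_mod_cast this
  have hRE := hS.restricted_eigenvalue m.A₀ j hj2 hj.ge h
  have hRE' : m.n * m.cLow * ‖h‖ ^ 2 ≤ ‖m.fit h‖ ^ 2 +
      m.n * m.cUp * s ^ 2 / ((K - 1) * m.q) := by
    refine hRE.trans ?_
    have hK1 : 0 < (K - 1) * m.q := by
      apply mul_pos <;> linarith
    have : m.cUp - m.cLow ≤ m.cUp := by linarith
    gcongr
  have hK1 : 0 < K - 1 := by linarith
  set y := √(m.n * m.cLow) * ‖h‖ / B with hy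
  have hy2 : y ^ 2 = m.n * m.cLow * ‖h‖ ^ 2 / B ^ 2 := by
    rw [hy, div_pow, mul_pow, Real.sq_sqrt (by positivity)]
  have hmain := sq_le_of_restricted_eigenvalue_of_cone (x := ‖m.fit h‖ / B) (y := y)
    (w := l * √(m.db : ℝ) * s / B ^ 2) (D := D) (K := K) (ρ := ρ) (by positivity) (by positivity)
    hD1 hρ0 hKD (by
      have e1 : (l * √(m.db : ℝ) * s / B ^ 2) ^ 2 / (K - 1) =
          m.n * m.cUp * s ^ 2 / ((K - 1) * m.q) / B ^ 2 := by
        have hdb2 : √(m.db : ℝ) ^ 2 = m.db := Real.sq_sqrt (by positivity)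
        rw [div_pow, mul_pow, mul_pow, hdb2, hB2]
        field_simp
      rw [hy2, e1, div_pow, ← add_div]
      gcongr) (by
      have e2 : √D * y * B ^ 2 = l * (√(m.da : ℝ) * (√(m.q : ℝ) * ‖h‖)) := by
        -- The scale `B` is chosen so that `D n c_* B² = λ² d_a q`.
        have e3 : √D * √(m.n * m.cLow) * B = l * √(m.da : ℝ) * √(m.q : ℝ) := by
          rw [hB, ← Real.sqrt_mul (by positivity), ← Real.sqrt_mul (by positivity), mul_assoc l,
            ← Real.sqrt_mul (by positivity), ← Real.sqrt_sq hl.le,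
            ← Real.sqrt_mul (by positivity), Real.sqrt_sq hl.le]
          congr 1
          rw [hD, GroupModel.d, cbar]
          field_simp
        calc √D * y * B ^ 2 = √D * √(m.n * m.cLow) * B * ‖h‖ := by
              rw [hy]; field_simp
          _ = _ := by rw [e3]; ring
      have e4 : ρ * B ^ 2 = 2 * (l * (√(m.da : ℝ) * m.η₁)) := by
        rw [hρ', hB2]
        field_simp
      rw [← mul_le_mul_iff_left₀ (pow_pos hBpos 2)]
      have e5 : ((‖m.fit h‖ / B) ^ 2 + 9 / 10 * (l * √(m.db : ℝ) * s / B ^ 2)) * B ^ 2 =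
          ‖m.fit h‖ ^ 2 + 9 / 10 * (l * (√(m.db : ℝ) * s)) := by
        field_simp
      have e6 : (11 / 10 * √D * y + ρ) * B ^ 2 = 11 / 10 * (√D * y * B ^ 2) + ρ * B ^ 2 := by
        ring
      rw [e5, e6, e2, e4]
      have e7 := mul_le_mul_of_nonneg_left hpA hl.le
      have e8 := mul_le_mul_of_nonneg_left hpS hl.le
      linarith)
  rw [← mul_right_comm, ← hD]
  exact ⟨(div_le_iff₀ hBpos).1 (Real.le_sqrt_of_sq_le hmain.1),
    (div_le_iff₀ hBpos).1 (Real.le_sqrt_of_sq_le hmain.2)⟩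

/-- The deterministic part: if the noise is small on all columns, then every group Lasso estimate
satisfies both error bounds. -/
lemma IsGroupLasso.error_le {σ l t : ℝ} (hσ : 0 < σ) (hl : 0 < l) (ht : t ≤ l / 10)
    (hn : 0 < m.n) (hq : 1 ≤ m.q) (hdim : ∀ k, 0 < m.dim k) (hG : m.GSC) (hS : m.SRC)
    (hM : m.M₁ l * m.q + 1 ≤ m.qstar)
    {e : Fin m.n → ℝ} (he : ∀ k j, |∑ i, m.X k i j * e i| ≤ t) {b : m.Coef}
    (hb : m.IsGroupLasso l (m.response e) b) :
    ‖b - m.β‖ ≤ m.estBound σ l ∧ ‖m.fit b - m.fit m.β‖ ≤ m.predBound σ l := by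
  obtain ⟨hx, hy⟩ := hb.scaled_error_le hl ht hn hq hdim hG hS hM he
  rw [← show m.fit (b - m.β) = m.fit b - m.fit m.β from m.fitLin.map_sub _ _]
  have hn' : (0 : ℝ) < m.n := by exact_mod_cast hn
  have hdb : (1 : ℝ) ≤ m.db := by exact_mod_cast db_pos hdim hq
  have hU := hS.cUp_pos
  have hLo := hS.2.1
  -- `d_b ≥ 1`, hence `d_b ≤ d_b²`.
  have hBB : √(l ^ 2 * m.db * m.q / (m.n * m.cUp)) ≤ m.B₁ l := by
    rw [B₁]
    gcongr
    nlinarith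
  have hr : 0 ≤ m.r₂ l * m.B₁ l := mul_nonneg (Real.sqrt_nonneg _) (Real.sqrt_nonneg _)
  have hnoise : 0 ≤ 2 * σ * √(m.M₁ l * Real.log m.Nd * m.q) := by positivity
  have hbd := mul_le_mul_of_nonneg_left hBB (Real.sqrt_nonneg (m.d * m.M₁ l * m.cbar))
  constructor
  · have h1 : 0 ≤ √((m.cLow * m.r₁ l ^ 2 + m.r₂ l ^ 2) / (m.cLow * m.cUp)) *
        (√(m.q : ℝ) * l / m.n) := by positivity
    have h2 : 0 < √(m.n * m.cLow) := Real.sqrt_pos.2 (by positivity)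
    have h3 : ‖b - m.β‖ ≤ 1 / √(m.n * m.cLow) *
        (2 * σ * √(m.M₁ l * Real.log m.Nd * m.q) +
        (m.r₂ l + √(m.d * m.M₁ l * m.cbar)) * m.B₁ l) := by
      rw [one_div, ← div_eq_inv_mul, le_div_iff₀ h2]
      linarith
    rw [estBound]
    linarith
  · rw [predBound]
    linarith

/-- The penalty level is at least `λ₀` only if the rank condition holds at that level. -/
lemma M₁_mul_q_add_one_le {l : ℝ} (hl : 0 < l) (hG : m.GSC) (hS : m.SRC) (hq : 1 ≤ m.q)
    (hdim : ∀ k, 0 < m.dim k) (h0 : m.lamZero ≤ (l : EReal)) :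
    m.M₁ l * m.q + 1 ≤ m.qstar := by
  have hq' : (1 : ℝ) ≤ m.q := by exact_mod_cast hq
  have hdb : (1 : ℝ) ≤ m.db := by exact_mod_cast db_pos hdim hq
  have hU := hS.cUp_pos
  have hη := hG.1
  -- `r₁`, `r₂` and hence `M₁` decrease in the penalty level, so the condition holds strictly above
  -- `λ₀`; continuity of `M₁` then reaches `l` itself.
  have key : ∀ x > l, m.M₁ x * m.q + 1 ≤ m.qstar := by
    intro x hx
    have h1 : m.lamZero < (x : EReal) := h0.trans_lt (EReal.coe_lt_coe_iff.2 hx)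
    obtain ⟨_, ⟨z, ⟨hz0, hz⟩, rfl⟩, hzx⟩ := sInf_lt_iff.1 h1
    have hzx' : z ≤ x := (EReal.coe_lt_coe_iff.1 hzx).le
    refine le_trans ?_ hz
    have e1 : m.r₁ x ≤ m.r₁ z := by
      rw [r₁, r₁]; gcongr
    have e2 : m.r₂ x ≤ m.r₂ z := by
      rw [r₂, r₂]; gcongr
    have e3 : 0 ≤ m.r₁ x := Real.sqrt_nonneg _
    rw [M₁, M₁]
    gcongr
  have hcont : ContinuousAt (fun x => m.M₁ x * m.q + 1) l := by
    have c1 : ContinuousAt m.r₁ l := by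
      refine ContinuousAt.sqrt (ContinuousAt.div (by fun_prop) (by fun_prop) ?_)
      positivity
    have c2 : ContinuousAt m.r₂ l := by
      refine ContinuousAt.sqrt (ContinuousAt.div (by fun_prop) (by fun_prop) ?_)
      positivity
    unfold M₁
    fun_prop
  exact le_of_tendsto (hcont.tendsto.mono_left (nhdsWithin_le_nhds (s := Set.Ioi l)))
    (mem_of_superset self_mem_nhdsWithin key)

end GroupModel
end

/-! ### Gaussian noise and the union bound -/

noncomputable section

/-- Tail bound for a linear combination of independent centred Gaussian variables. -/
lemma measure_lt_abs_sum_gaussian_le {ι Ω : Type*} [Fintype ι] [MeasurableSpace Ω]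
    {μ : Measure Ω} {ε : ι → Ω → ℝ} {v : NNReal} (hindep : iIndepFun ε μ)
    (hlaw : ∀ j, HasLaw (ε j) (gaussianReal 0 v) μ) (x : ι → ℝ) {c : ℝ}
    (hc : v * ∑ i, x i ^ 2 ≤ c) {t : ℝ} (ht : 0 ≤ t) :
    μ {ω | t < |∑ i, x i * ε i ω|} ≤ ENNReal.ofReal (2 * Real.exp (-t ^ 2 / (2 * c))) := by
  have : IsProbabilityMeasure μ := hindep.isProbabilityMeasure
  have hsub : ∀ j, HasSubgaussianMGF (ε j) v μ := fun j =>
    { integrable_exp_mul := fun s => by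
        rw [← mgf_pos_iff, mgf_gaussianReal (hlaw j).map_eq]
        positivity
      mgf_le := fun s => by rw [mgf_gaussianReal (hlaw j).map_eq, zero_mul, zero_add] }
  have hind : iIndepFun (fun i ω => x i * ε i ω) μ :=
    hindep.comp (fun i y => x i * y) fun i => by fun_prop
  have hsum := HasSubgaussianMGF.sum_of_iIndepFun hind (s := Finset.univ)
    fun i _ => (hsub i).const_mul (x i)
  have hc0 : 0 ≤ c := le_trans (by positivity) hc
  -- The variance proxy may be enlarged to `c`, so one tail bound serves columns of different norms.
  have hc' : HasSubgaussianMGF (fun ω => ∑ i, x i * ε i ω) ⟨c, hc0⟩ μ :=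
    { integrable_exp_mul := hsum.integrable_exp_mul
      mgf_le := fun s => by
        refine (hsum.mgf_le s).trans ?_
        gcongr
        refine le_trans (le_of_eq ?_) hc
        push_cast
        rw [Finset.mul_sum]
        exact Finset.sum_congr rfl fun i _ => mul_comm _ _ }
  have h1 := hc'.measure_ge_le ht
  have h2 := hc'.neg.measure_ge_le ht
  have hsubset : {ω | t < |∑ i, x i * ε i ω|} ⊆
      {ω | t ≤ ∑ i, x i * ε i ω} ∪ {ω | t ≤ (-fun ω => ∑ i, x i * ε i ω) ω} := by
    intro ω hω
    rcases lt_abs.1 (show t < |∑ i, x i * ε i ω| from hω) with h | h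
    · exact Or.inl h.le
    · exact Or.inr h.le
  rw [← ofReal_measureReal]
  refine ENNReal.ofReal_le_ofReal ?_
  refine (measureReal_mono hsubset).trans ((measureReal_union_le _ _).trans ?_)
  rw [two_mul]
  exact add_le_add h1 h2

namespace GroupModel

variable {m : GroupModel}

/-- A column is the image of a unit vector supported on one group, so the upper Riesz bound applies;
it caps the noise variance along every column. -/
lemma SRC.sum_sq_col_le (hS : m.SRC) (hq : 1 ≤ m.qstar) (k : Fin m.p) (j : Fin (m.dim k)) :
    ∑ i, m.X k i j ^ 2 ≤ m.n * m.cUp := by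
  set v : m.Coef := WithLp.toLp 2 (Pi.single k (EuclideanSpace.single j (1 : ℝ))) with hv
  have hvk : v k = EuclideanSpace.single j 1 := by simp [hv]
  have hv0 : ∀ l ∉ ({k} : Finset (Fin m.p)), v l = 0 := fun l hl => by
    rw [Finset.mem_singleton] at hl
    simp [hv, hl]
  have h1 := (hS.bounds (by simpa using hq) hv0).2
  rw [← m.fitOn_eq_fit hv0, norm_sq_eq, ← Finset.sum_subset (Finset.subset_univ {k})
    (fun l _ hl => by rw [hv0 l hl]; simp), Finset.sum_singleton, fitOn, Finset.sum_singleton, hvk,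
    EuclideanSpace.norm_sq_eq] at h1
  simpa using h1

lemma Nd_le (m : GroupModel) : m.Nd ≤ m.p * m.da := by
  refine (Finset.sum_le_card_nsmul _ _ m.da fun k _ => dim_le_da k).trans ?_
  simp

lemma p_le_Nd (hdim : ∀ k, 0 < m.dim k) : m.p ≤ m.Nd := by
  rw [Nd]
  simpa using Finset.card_nsmul_le_sum Finset.univ m.dim 1 fun k _ => hdim k

/-- With high probability all columns of the design are almost orthogonal to the noise. -/
lemma measure_exists_lt_abs_sum_le {Ω : Type*} [MeasurableSpace Ω] {μ : Measure Ω}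
    {ε : Fin m.n → Ω → ℝ} {σ c₀ N : ℝ} (hσ : 0 < σ) (hc₀ : 0 ≤ c₀) (hN : 1 ≤ N)
    (hn : 0 < m.n) (hS : m.SRC) (hq : 1 ≤ m.qstar)
    (hindep : iIndepFun ε μ)
    (hlaw : ∀ j, HasLaw (ε j) (gaussianReal 0 (Real.toNNReal (σ ^ 2))) μ) :
    μ {ω | ¬ ∀ k j, |∑ i, m.X k i j * ε i ω| ≤
        σ * √(2 * (1 + c₀) * m.n * m.cUp * Real.log N)} ≤
      ENNReal.ofReal (2 * (m.p * m.da / N ^ (1 + c₀))) := by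
  have hU := hS.cUp_pos
  have hn' : (0 : ℝ) < m.n := by exact_mod_cast hn
  have hlog : 0 ≤ Real.log N := Real.log_nonneg hN
  set t := σ * √(2 * (1 + c₀) * m.n * m.cUp * Real.log N) with ht
  have ht0 : 0 ≤ t := by positivity
  have ht2 : t ^ 2 = σ ^ 2 * (2 * (1 + c₀) * m.n * m.cUp * Real.log N) := by
    rw [ht, mul_pow, Real.sq_sqrt (by positivity)]
  have hexp : Real.exp (-t ^ 2 / (2 * (σ ^ 2 * (m.n * m.cUp)))) = 1 / N ^ (1 + c₀) := by
    have : -t ^ 2 / (2 * (σ ^ 2 * (m.n * m.cUp))) = Real.log N * -(1 + c₀) := by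
      rw [ht2]
      field_simp
    rw [this, ← Real.rpow_def_of_pos (by linarith), Real.rpow_neg (by linarith), one_div]
  have hsub : {ω | ¬ ∀ k j, |∑ i, m.X k i j * ε i ω| ≤ t} ⊆
      ⋃ kj : (k : Fin m.p) × Fin (m.dim k), {ω | t < |∑ i, m.X kj.1 i kj.2 * ε i ω|} := by
    intro ω hω
    simp only [Set.mem_ofPred_eq, not_forall, not_le] at hω
    obtain ⟨k, j, h⟩ := hω
    exact Set.mem_iUnion.2 ⟨⟨k, j⟩, h⟩
  have htail : ∀ kj : (k : Fin m.p) × Fin (m.dim k),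
      μ {ω | t < |∑ i, m.X kj.1 i kj.2 * ε i ω|} ≤ ENNReal.ofReal (2 * (1 / N ^ (1 + c₀))) := by
    intro kj
    rw [← hexp]
    refine measure_lt_abs_sum_gaussian_le hindep hlaw (fun i => m.X kj.1 i kj.2) ?_ ht0
    rw [Real.coe_toNNReal _ (sq_nonneg σ)]
    exact mul_le_mul_of_nonneg_left (hS.sum_sq_col_le hq kj.1 kj.2) (sq_nonneg σ)
  refine (measure_mono hsub).trans ((measure_iUnion_fintype_le _ _).trans ?_)
  refine (Finset.sum_le_sum fun kj _ => htail kj).trans ?_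
  rw [Finset.sum_const, nsmul_eq_mul, Finset.card_univ, Fintype.card_sigma]
  simp only [Fintype.card_fin]
  rw [show ∑ k, m.dim k = m.Nd from rfl, ← ENNReal.ofReal_natCast,
    ← ENNReal.ofReal_mul (Nat.cast_nonneg _)]
  refine ENNReal.ofReal_le_ofReal ?_
  have h1 : (m.Nd : ℝ) ≤ m.p * m.da := by exact_mod_cast m.Nd_le
  have h2 : (0 : ℝ) < N ^ (1 + c₀) := Real.rpow_pos_of_pos (by linarith) _
  calc (m.Nd : ℝ) * (2 * (1 / N ^ (1 + c₀))) ≤ (m.p * m.da) * (2 * (1 / N ^ (1 + c₀))) := by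
        gcongr
    _ = _ := by ring

/-! ### Calibration of the penalty level -/

/-- The threshold for the noise is a small fraction of `λ_{n,p}`. -/
lemma noise_le_lamNP {σ c₀ a : ℝ} (hσ : 0 < σ) (hc₀ : 0 ≤ c₀) (hdim : ∀ k, 0 < m.dim k)
    (hq : 1 ≤ m.q) (hS : m.SRC) (hq7 : 7 ≤ m.qstar) (hNd : 1 ≤ m.Nd) :
    10 * (σ * √(2 * (1 + c₀) * m.n * m.cUp * Real.log (max (m.Nd : ℝ) a))) ≤
      m.lamNP σ c₀ a := by
  have hU := hS.cUp_pos
  have hlog : 0 ≤ Real.log (max (m.Nd : ℝ) a) :=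
    Real.log_nonneg (le_max_of_le_left (by exact_mod_cast hNd))
  have hd := one_le_d hdim hq
  have hc := hS.one_le_cbar
  have hda : (1 : ℝ) ≤ m.da := by exact_mod_cast (db_pos hdim hq).trans_le (db_le_da hq)
  have hq' : (7 : ℝ) ≤ m.qstar := by exact_mod_cast hq7
  have hprod : 7 ≤ m.da * m.d ^ 2 * m.qstar * m.cbar := by
    have h1 : 1 ≤ (m.da : ℝ) * m.d ^ 2 := one_le_mul_of_one_le_of_one_le hda (one_le_pow₀ hd)
    have h2 : 7 ≤ (m.da : ℝ) * m.d ^ 2 * m.qstar := by nlinarith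
    nlinarith
  set L := (1 + c₀) * m.n * m.cUp * Real.log (max (m.Nd : ℝ) a) with hL
  have hL0 : 0 ≤ L := by positivity
  -- After squaring: `10² * 2 = 200 ≤ 224 = 2² * 8 * 7`.
  have e1 : 10 * √(2 * (1 + c₀) * m.n * m.cUp * Real.log (max (m.Nd : ℝ) a)) ≤
      2 * √(8 * (1 + c₀) * m.da * m.d ^ 2 * m.qstar * m.cbar * m.n * m.cUp *
        Real.log (max (m.Nd : ℝ) a)) := by
    refine le_of_sq_le_sq ?_ (by positivity)
    rw [mul_pow, mul_pow, Real.sq_sqrt (by positivity), Real.sq_sqrt (by positivity)]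
    have := mul_le_mul_of_nonneg_right hprod hL0
    rw [hL] at this
    nlinarith
  rw [lamNP]
  nlinarith

/-- Supplies `0 < λ`, without which `r₁`, `r₂` and the scaling degenerate; `N_d ≥ 2` makes the
logarithm positive. -/
lemma lamNP_pos {σ c₀ a : ℝ} (hσ : 0 < σ) (hc₀ : 0 ≤ c₀) (hdim : ∀ k, 0 < m.dim k)
    (hq : 1 ≤ m.q) (hn : 0 < m.n) (hS : m.SRC) (hq1 : 1 ≤ m.qstar) (hNd : 2 ≤ m.Nd) :
    0 < m.lamNP σ c₀ a := by
  have hU := hS.cUp_pos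
  have hlog : 0 < Real.log (max (m.Nd : ℝ) a) :=
    Real.log_pos (lt_max_of_lt_left (by exact_mod_cast hNd))
  have hd := one_le_d hdim hq
  have hc := hS.one_le_cbar
  have hda : (0 : ℝ) < m.da := by exact_mod_cast (db_pos hdim hq).trans_le (db_le_da hq)
  have hn' : (0 : ℝ) < m.n := by exact_mod_cast hn
  have hq' : (0 : ℝ) < m.qstar := by exact_mod_cast hq1
  have hd' : 0 < m.d := by linarith
  have hc' : 0 < m.cbar := by linarith
  rw [lamNP]
  positivity

/-- Non-asymptotic form of the error bounds for group Lasso estimates. -/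
lemma one_sub_le_measure_error_le {Ω : Type*} [MeasurableSpace Ω] {μ : Measure Ω}
    [IsProbabilityMeasure μ] {ε : Fin m.n → Ω → ℝ} {σ c₀ l a : ℝ} (hσ : 0 < σ) (hc₀ : 0 ≤ c₀)
    (hq : 1 ≤ m.q) (hqn : m.q ≤ m.n) (hp : 2 ≤ m.p) (hdim : ∀ k, 0 < m.dim k)
    (hG : m.GSC) (hS : m.SRC)
    (hlam : max m.lamZero ((m.lamNP σ c₀ a : ℝ) : EReal) ≤ (l : EReal))
    (hindep : iIndepFun ε μ)
    (hlaw : ∀ j, HasLaw (ε j) (gaussianReal 0 (Real.toNNReal (σ ^ 2))) μ) :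
    1 - ENNReal.ofReal (2 * (m.p * m.da / (max (m.Nd : ℝ) a) ^ (1 + c₀))) ≤
      μ {ω | ∀ b : m.Coef, m.IsGroupLasso l (m.response (fun j => ε j ω)) b →
          ‖b - m.β‖ ≤ m.estBound σ l ∧ ‖m.fit b - m.fit m.β‖ ≤ m.predBound σ l} := by
  have hn : 0 < m.n := by omega
  have hNd : 2 ≤ m.Nd := hp.trans (p_le_Nd hdim)
  obtain ⟨hl0, hlNP⟩ := max_le_iff.1 hlam
  have hlNP' : m.lamNP σ c₀ a ≤ l := EReal.coe_le_coe_iff.1 hlNP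
  have hq' : (1 : ℝ) ≤ m.q := by exact_mod_cast hq
  have hD1 : 1 ≤ m.d * m.cbar := one_le_mul_of_one_le_of_one_le (one_le_d hdim hq) hS.one_le_cbar
  have hM6 : ∀ x, 6 ≤ m.M₁ x := fun x => by
    have := m.two_add_le_M₁ x
    nlinarith [sq_nonneg (m.r₁ x)]
  have hseven : ∀ x, m.M₁ x * m.q + 1 ≤ m.qstar → 7 ≤ m.qstar := fun x hx => by
    have : (7 : ℝ) ≤ m.qstar := by nlinarith [hM6 x]
    exact_mod_cast this
  -- `λ₀ ≤ l < ∞`, so some level satisfies the rank condition; there `M₁ ≥ 6` and `q ≥ 1` give `q^*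
  -- ≥ 7`.
  have hq7 : 7 ≤ m.qstar := by
    obtain ⟨_, ⟨x, ⟨-, hx⟩, rfl⟩, -⟩ := sInf_lt_iff.1 (hl0.trans_lt (EReal.coe_lt_top l))
    exact hseven x hx
  have hl : 0 < l := (lamNP_pos hσ hc₀ hdim hq hn hS (by omega) hNd).trans_le hlNP'
  have hM := M₁_mul_q_add_one_le hl hG hS hq hdim hl0
  set t := σ * √(2 * (1 + c₀) * m.n * m.cUp * Real.log (max (m.Nd : ℝ) a)) with ht
  have htl : t ≤ l / 10 := by
    have := noise_le_lamNP (a := a) hσ hc₀ hdim hq hS hq7 (by omega)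
    linarith
  have hN : 1 ≤ max (m.Nd : ℝ) a :=
    le_max_of_le_left (by exact_mod_cast (by omega : 1 ≤ m.Nd))
  have hbad := measure_exists_lt_abs_sum_le hσ hc₀ hN hn hS (by omega) hindep hlaw
  set E := {ω | ∀ k j, |∑ i, m.X k i j * ε i ω| ≤ t} with hE
  have hbad' : μ Eᶜ ≤ ENNReal.ofReal (2 * (m.p * m.da / (max (m.Nd : ℝ) a) ^ (1 + c₀))) := hbad
  -- Subadditivity suffices, so `E` need not be measurable.
  have hone : 1 ≤ μ E + μ Eᶜ := by
    rw [← measure_univ (μ := μ), ← Set.union_compl_self E]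
    exact measure_union_le _ _
  calc _ ≤ 1 - μ Eᶜ := tsub_le_tsub_left hbad' _
    _ ≤ μ E := tsub_le_iff_right.2 hone
    _ ≤ _ := by
      refine measure_mono fun ω hω => ?_
      intro b hb
      exact hb.error_le hσ hl htl hn hq hdim hG hS hM hω

end GroupModel
end

/-! ### Passage to the limit -/

theorem theorem2
    (m : ℕ → GroupModel) (lam a : ℕ → ℝ)
    (cbar σ r₁ r₂ c₀ d : ℝ) (hσ : 0 < σ) (hc₀ : 0 ≤ c₀)
    -- the fixed quantities
    (hcbar : ∀ i, (m i).cbar = cbar)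
    (hr₁ : ∀ i, (m i).r₁ (lam i) = r₁)
    (hr₂ : ∀ i, (m i).r₂ (lam i) = r₂)
    (hd : ∀ i, (m i).d = d)
    -- `1 ≤ q ≤ n ≤ p → ∞`, with non-empty groups
    (hq : ∀ i, 1 ≤ (m i).q) (hqn : ∀ i, (m i).q ≤ (m i).n) (hnp : ∀ i, (m i).n ≤ (m i).p)
    (hp : Tendsto (fun i => (m i).p) atTop atTop)
    (hdim : ∀ i k, 0 < (m i).dim k)
    -- generalized sparsity and sparse Riesz condition
    (hGSC : ∀ i, (m i).GSC) (hSRC : ∀ i, (m i).SRC)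
    -- the penalty level
    (ha : ∀ i, 0 ≤ a i)
    (hpa : Tendsto (fun i => ((m i).p * (m i).da : ℝ) /
      (max ((m i).Nd : ℝ) (a i)) ^ (1 + c₀)) atTop (𝓝 0))
    (hlam : ∀ i, max (m i).lamZero (((m i).lamNP σ c₀ (a i) : ℝ) : EReal) ≤ (lam i : EReal))
    -- independent `N(0, σ²)` errors
    {Ω : ℕ → Type*} [∀ i, MeasurableSpace (Ω i)]
    (μ : ∀ i, Measure (Ω i)) [∀ i, IsProbabilityMeasure (μ i)]
    (ε : ∀ i, Fin (m i).n → Ω i → ℝ)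
    (hindep : ∀ i, iIndepFun (ε i) (μ i))
    (hlaw : ∀ i j, HasLaw (ε i j) (gaussianReal 0 (Real.toNNReal (σ ^ 2))) (μ i)) :
    Tendsto (fun i => μ i {ω | ∀ b : (m i).Coef,
        (m i).IsGroupLasso (lam i) ((m i).response (fun j => ε i j ω)) b →
          ‖b - (m i).β‖ ≤ (m i).estBound σ (lam i) ∧
          ‖(m i).fit b - (m i).fit (m i).β‖ ≤ (m i).predBound σ (lam i)})
      atTop (𝓝 1) := by
  have hlim : Tendsto (fun i => 1 - ENNReal.ofReal (2 * (((m i).p * (m i).da : ℝ) /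
      (max ((m i).Nd : ℝ) (a i)) ^ (1 + c₀)))) atTop (𝓝 1) := by
    have h1 := ENNReal.tendsto_ofReal (hpa.const_mul 2)
    rw [mul_zero, ENNReal.ofReal_zero] at h1
    simpa using ENNReal.Tendsto.sub (tendsto_const_nhds (x := (1 : ENNReal))) h1
      (Or.inl ENNReal.one_ne_top)
  refine tendsto_of_tendsto_of_tendsto_of_le_of_le' hlim tendsto_const_nhds ?_
    (Eventually.of_forall fun i => prob_le_one)
  -- `p ≥ 2` ensures `N_d ≥ 2`, hence a positive `λ_{n,p}`.
  filter_upwards [hp.eventually_ge_atTop 2] with i hi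
  exact GroupModel.one_sub_le_measure_error_le hσ hc₀ (hq i) (hqn i) hi (hdim i) (hGSC i) (hSRC i)
    (hlam i) (hindep i) (hlaw i)
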